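/- Lemma (Measure Density Lemma). Let $V$ be a universal (optimal) plain decompressor on binary strings: $V$ is partial computable and, with $C_U(x)=\min\{|p| : U(p)=x\}$ (and $C_U(x)=\infty$ if there is no such $p$), for every partial computable $U$ there is a constant $M$ such that $C_V(x)\le C_U(x)+M$ for all $x$. Let $(x,y)\mapsto[x,y]$ be a computable injective pairing of binary strings, and write $C_V(x,y)=C_V([x,y])$. Let $\mathbf m(x\mid y)$ be a universal conditional semimeasure (a priori probability) on binary strings, that is, a lower semicomputable function with $\sum_x \mathbf m(x\mid y)\le 1$ for all $y$ such that for every other such function $\mu$ there is $c>0$ with $\mu(x\mid y)\le c\,\mathbf m(x\mid y)$ for all $x,y$. A natural number in the condition is represented by its binary expansion. For natural numbers $n,\delta$ and a string $y$ put \[ T_n^\delta(y)=\{s : C_V(y,s)\le 2^n+\delta\},\qquad T_n(y)=T_n^0(y). \] Then there are constants $a,A\in\mathbb N$ and $c_1,c_2>0$, depending only on $V$, $\mathbf m$ and the pairing function, such that for every natural number $n$ and every string $y$ with $|y|<2^n/2-a$: 1. (Standard threshold) $\mathbf m(y\mid n)\le c_1\,|T_n(y)|\cdot 2^{-2^n}$.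 2. (Relaxed threshold) For every integer $\delta\ge 0$, $\mathbf m(y\mid n)\ge c_2\,|T_n^\delta(y)|\cdot 2^{-2^n-A\delta}$. Since $n$ is arbitrary, the same inequalities, with the same constants, hold with any other natural number $q$ in place of $n$, for $|y|<2^q/2-a$. -/

import Mathlib

open scoped NNReal ENNReal

/-- Plain Kolmogorov complexity of the binary string `x` relative to the (unconditional)
decompressor `U`: the least length of a `p` with `U p = x`, and `⊤` if there is no such `p`. -/
noncomputable def plainComplexity (U : List Bool →. List Bool) (x : List Bool) : ℕ∞ :=
  ⨅ (p : List Bool) (_ : x ∈ U p), (p.length : ℕ∞)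

/-- A universal (optimal) decompressor: a partial computable function `U` on binary strings such
that `C_U ≤ C_{U'} + O(1)` for every partial computable `U'`. -/
def IsUniversalDecompressor (U : List Bool →. List Bool) : Prop :=
  Partrec U ∧ ∀ U' : List Bool →. List Bool, Partrec U' →
    ∃ M : ℕ, ∀ x : List Bool, plainComplexity U x ≤ plainComplexity U' x + M

/-- `μ x y`, read `μ(x | y)`, is a conditional semimeasure: `∑ₓ μ(x | y) ≤ 1` for every `y`. -/
def IsCondSemimeasure (μ : List Bool → List Bool → ℝ≥0∞) : Prop :=
  ∀ y : List Bool, ∑' x : List Bool, μ x y ≤ 1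

/-- `μ(x | y)` is lower semicomputable: it is the limit of a nondecreasing sequence of nonnegative
rationals `a / (b + 1)`, where `(a, b)` is computable from `x`, `y` and the index `k`. -/
def IsLowerSemicomputable (μ : List Bool → List Bool → ℝ≥0∞) : Prop :=
  ∃ φ : List Bool × List Bool × ℕ → ℕ × ℕ, Computable φ ∧ ∀ x y : List Bool,
    Monotone (fun k : ℕ => ((φ (x, y, k)).1 : ℝ≥0∞) / ((φ (x, y, k)).2 + 1)) ∧
    ⨆ k : ℕ, ((φ (x, y, k)).1 : ℝ≥0∞) / ((φ (x, y, k)).2 + 1) = μ x y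

/-- `m` is a universal conditional semimeasure (a priori probability): a lower semicomputable
conditional semimeasure that dominates every other one up to a constant factor. -/
def IsUniversalSemimeasure (m : List Bool → List Bool → ℝ≥0∞) : Prop :=
  IsCondSemimeasure m ∧ IsLowerSemicomputable m ∧
    ∀ μ : List Bool → List Bool → ℝ≥0∞, IsCondSemimeasure μ → IsLowerSemicomputable μ →
      ∃ c : ℝ≥0, 0 < c ∧ ∀ x y : List Bool, μ x y ≤ c * m x y

/-- The set of extensions `T_n^δ(y) = {s : C_V(y, s) ≤ 2^n + δ}`, where the complexity of a pair
is that of its code under the pairing function `pair`. The standard set `T_n(y)` is `δ = 0`. -/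
def extensionSet (V : List Bool →. List Bool) (pair : List Bool → List Bool → List Bool)
    (n δ : ℕ) (y : List Bool) : Set (List Bool) :=
  {s | plainComplexity V (pair y s) ≤ ((2 ^ n + δ : ℕ) : ℕ∞)}

/-! Both bounds trade short programs against probability at the threshold `N = 2 ^ n`.

Upper bound: the pairs `(y, j)` with `(j + 1) / 2 ^ l < m(y | z)` can be enumerated, and there are
at most `2 ^ l` of them because the masses sum to at most one. A program of length `l` can therefore
name any of them by its position. For `l = N - O(1)` the binary size of `l` is `n`, so the length of
the program already reveals the condition, at no cost in bits. Hence `[y, j]` has complexity at most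
`N` for every `j` with `j + 1 < m(y | n) * 2 ^ l` (`exists_plainComplexity_pair_bits_le`).

Lower bound: a program `p` of `V` gets weight `2 ^ (-(N + 2 * max(|p| - N, 0) + 2))` and passes it
to `y` if it outputs some `[y, s]`. Programs are not prefix-free, but only `2 ^ k` have length `k`:
lengths below `N` share a bounded mass, and doubling the excess makes the rest converge
(`tsum_weightExponent_le_one`). This semimeasure is dominated by `m`, and each `s` in `T_n^δ(y)`
contributes at least `2 ^ (-(N + 2δ + 2))`. -/

/-! ### Computability of binary expansions -/

theorem Primrec.nat_bits : Primrec Nat.bits := by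
  have hg : Primrec₂ fun (_ : Unit) (l : List (List Bool)) =>
      bif l.length == 0 then some []
      else (l[l.length.div2]?).map (List.cons l.length.bodd) := by
    have hlen : Primrec fun q : Unit × List (List Bool) => q.2.length :=
      Primrec.list_length.comp Primrec.snd
    refine Primrec.cond (Primrec.beq.comp hlen (Primrec.const 0)) (Primrec.const _) ?_
    exact Primrec.option_map
      (Primrec.list_getElem?.comp Primrec.snd (Primrec.nat_div2.comp hlen))
      (Primrec.list_cons.comp (Primrec.nat_bodd.comp (hlen.comp Primrec.fst)) Primrec.snd)
  have := Primrec.nat_strong_rec (fun (_ : Unit) n => Nat.bits n) hg ?_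
  · exact this.comp (Primrec.const ()) Primrec.id
  · rintro - n
    rcases Nat.eq_zero_or_pos n with rfl | hn
    · simp
    · have h2 : n.div2 < n := by rw [Nat.div2_val]; omega
      have hb : n.bits = n.bodd :: n.div2.bits := by
        conv_lhs => rw [← Nat.bit_bodd_div2 n]
        refine Nat.bits_append_bit _ _ fun h0 => ?_
        have := Nat.bit_bodd_div2 n
        rw [h0] at this
        cases hbd : n.bodd
        · rw [hbd] at this; simp at this; omega
        · rfl
      have h0 : (n == 0) = false := by simpa using hn.ne'
      simp [h0, h2, hb]

theorem Primrec.nat_two_pow : Primrec fun n : ℕ => 2 ^ n := by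
  refine (Primrec.nat_rec₁ (f := fun _ k => 2 * k) 1
    (Primrec.nat_double.comp Primrec.snd)).of_eq fun n => ?_
  induction n with
  | zero => rfl
  | succ n ih => simp only [ih, pow_succ]; ring

/-- The number whose binary digits, least significant first, are the given ones. -/
def natOfBits (l : List Bool) : ℕ := l.foldr (fun b n => bif b then 2 * n + 1 else 2 * n) 0

theorem Primrec.natOfBits : Primrec natOfBits := by
  refine Primrec.list_foldr Primrec.id (Primrec.const 0) (h := fun _ q =>
    bif q.1 then 2 * q.2 + 1 else 2 * q.2) ?_
  have h2 : Primrec fun q : List Bool × Bool × ℕ => q.2.2 := Primrec.snd.comp Primrec.snd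
  exact Primrec.cond (Primrec.fst.comp Primrec.snd) (Primrec.nat_double_succ.comp h2)
    (Primrec.nat_double.comp h2)

theorem natOfBits_cons (b : Bool) (l : List Bool) :
    natOfBits (b :: l) = Nat.bit b (natOfBits l) := by
  cases b <;> rfl

theorem natOfBits_bits (n : ℕ) : natOfBits n.bits = n := by
  induction n using Nat.binaryRec' with
  | zero => rfl
  | bit b n h ih => rw [Nat.bits_append_bit n b h, natOfBits_cons, ih]

theorem Nat.bits_injective : Function.Injective Nat.bits :=
  Function.LeftInverse.injective natOfBits_bits

/-- Leading zeros are allowed, so a position can be padded to length exactly `l`; the length of a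
program is thus free to carry information. -/
theorem exists_natOfBits_eq (l : ℕ) : ∀ r < 2 ^ l, ∃ p : List Bool, p.length = l ∧ natOfBits p = r := by
  induction l with
  | zero => intro r hr; exact ⟨[], rfl, by simp at hr; simp [hr, natOfBits]⟩
  | succ l ih =>
    intro r hr
    obtain ⟨p, hp, hpr⟩ := ih r.div2 (by rw [Nat.div2_val]; omega)
    exact ⟨r.bodd :: p, by simp [hp], by rw [natOfBits_cons, hpr, Nat.bit_bodd_div2]⟩

/-! ### First true index of a monotone Boolean sequence -/

/-- `k` is the first index at which `f` is true, for a sequence `f` that stays true once it is. -/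
def isFirst (f : ℕ → Bool) (k : ℕ) : Bool := f k && (k == 0 || !f (k - 1))

theorem Computable.isFirst {α : Type*} [Primcodable α] {f : α → ℕ → Bool} (hf : Computable₂ f) :
    Computable₂ fun a k => isFirst (f a) k := by
  refine Primrec.and.to_comp.comp hf (Primrec.or.to_comp.comp
    (Primrec.beq.to_comp.comp Computable.snd (Computable.const 0)) (Primrec.not.to_comp.comp ?_))
  exact hf.comp Computable.fst (Primrec.pred.to_comp.comp Computable.snd)

theorem isFirst_unique {f : ℕ → Bool} (hf : Monotone f) {k l : ℕ} (hk : isFirst f k = true)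
    (hl : isFirst f l = true) : k = l := by
  have key : ∀ {k l : ℕ}, isFirst f k = true → isFirst f l = true → ¬ k < l := by
    intro k l hk hl hkl
    simp only [isFirst, Bool.and_eq_true, Bool.or_eq_true, beq_iff_eq, Bool.not_eq_true'] at hk hl
    have := hf (show k ≤ l - 1 by omega)
    rcases hl.2 with h | h
    · omega
    · rw [hk.1, h] at this; exact absurd this (by decide)
  rcases lt_trichotomy k l with h | h | h
  · exact absurd h (key hk hl)
  · exact h
  · exact absurd h (key hl hk)

theorem exists_isFirst {f : ℕ → Bool} (h : ∃ k, f k = true) : ∃ k, isFirst f k = true := by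
  refine ⟨Nat.find h, ?_⟩
  simp only [isFirst, Nat.find_spec h, Bool.true_and, Bool.or_eq_true, beq_iff_eq,
    Bool.not_eq_true']
  rcases Nat.eq_zero_or_pos (Nat.find h) with h0 | h0
  · exact Or.inl h0
  · exact Or.inr (by simpa using Nat.find_min h (show Nat.find h - 1 < Nat.find h by omega))

theorem apply_of_isFirst {f : ℕ → Bool} {k : ℕ} (h : isFirst f k = true) : f k = true := by
  simp only [isFirst, Bool.and_eq_true] at h
  exact h.1

/-! ### Lower semicomputability of sums of dyadic weights -/

/-- A pair `(a, b)` encodes `a / (b + 1)`, hence the `- 1` in the new second component. -/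
theorem ENNReal.add_dyadic (a b e : ℕ) :
    ((a * 2 ^ e + (b + 1) : ℕ) : ℝ≥0∞) / (((b + 1) * 2 ^ e - 1 : ℕ) + 1) =
      (a : ℝ≥0∞) / (b + 1) + (2 ^ e)⁻¹ := by
  have h1 : (((b + 1) * 2 ^ e - 1 : ℕ) : ℝ≥0∞) + 1 = (b + 1) * 2 ^ e := by
    have : 1 ≤ (b + 1) * 2 ^ e := Nat.mul_pos b.succ_pos (by positivity)
    exact_mod_cast congrArg (Nat.cast (R := ℝ≥0∞)) (Nat.sub_add_cancel this)
  have he : (2 : ℝ≥0∞) ^ e ≠ 0 := by positivity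
  have he' : (2 : ℝ≥0∞) ^ e ≠ ⊤ := by finiteness
  have hb : ((b : ℝ≥0∞) + 1) ≠ 0 := by positivity
  have hb' : ((b : ℝ≥0∞) + 1) ≠ ⊤ := by finiteness
  rw [h1]
  push_cast
  rw [ENNReal.add_div, ENNReal.mul_div_mul_right _ _ he he', ← one_div,
    ← ENNReal.mul_div_mul_left 1 (2 ^ e) hb hb', mul_one]

/-- The weight `2 ^ (-e)` of `some e`, with no weight for `none`. -/
noncomputable def dyadicWeight : Option ℕ → ℝ≥0∞
  | none => 0
  | some e => (2 ^ e)⁻¹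

theorem isLowerSemicomputable_tsum_nat {w : (List Bool × List Bool) × ℕ → Option ℕ}
    (hw : Computable w) :
    IsLowerSemicomputable fun x y => ∑' i, dyadicWeight (w ((x, y), i)) := by
  let step : (List Bool × List Bool) → ℕ → ℕ × ℕ → ℕ × ℕ := fun q i s =>
    Option.casesOn (w (q, i)) s fun e => (s.1 * 2 ^ e + (s.2 + 1), (s.2 + 1) * 2 ^ e - 1)
  let F : (List Bool × List Bool) → ℕ → ℕ × ℕ := fun q k =>
    Nat.rec (0, 0) (fun i s => step q i s) k
  have hF : ∀ q k, ((F q k).1 : ℝ≥0∞) / ((F q k).2 + 1) =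
      ∑ i ∈ Finset.range k, dyadicWeight (w (q, i)) := by
    intro q k
    induction k with
    | zero => simp [F]
    | succ k ih =>
      have hs : F q (k + 1) = step q k (F q k) := rfl
      rw [Finset.sum_range_succ, ← ih, hs]
      simp only [step]
      cases w (q, k) with
      | none => simp [dyadicWeight]
      | some e => exact ENNReal.add_dyadic _ _ _
  refine ⟨fun q => F (q.1, q.2.1) q.2.2, ?_, fun x y => ⟨?_, ?_⟩⟩
  · refine Computable.nat_rec (f := fun q : List Bool × List Bool × ℕ => q.2.2)
      (g := fun _ => ((0, 0) : ℕ × ℕ)) (h := fun q p => step (q.1, q.2.1) p.1 p.2)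
      (Computable.snd.comp Computable.snd) (Computable.const _) ?_
    have hs : Computable fun q : (List Bool × List Bool × ℕ) × ℕ × ℕ × ℕ => q.2.2 :=
      Computable.snd.comp Computable.snd
    refine Computable.option_casesOn
      (o := fun q : (List Bool × List Bool × ℕ) × ℕ × ℕ × ℕ => w ((q.1.1, q.1.2.1), q.2.1))
      (f := fun q => q.2.2)
      (g := fun q e => (q.2.2.1 * 2 ^ e + (q.2.2.2 + 1), (q.2.2.2 + 1) * 2 ^ e - 1)) ?_ hs ?_
    · refine hw.comp (Computable.pair (Computable.pair ?_ ?_) ?_)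
      · exact Computable.fst.comp Computable.fst
      · exact Computable.fst.comp (Computable.snd.comp Computable.fst)
      · exact Computable.fst.comp Computable.snd
    · have hp : Primrec fun q : ((List Bool × List Bool × ℕ) × ℕ × ℕ × ℕ) × ℕ => 2 ^ q.2 :=
        Primrec.nat_two_pow.comp Primrec.snd
      have ha : Primrec fun q : ((List Bool × List Bool × ℕ) × ℕ × ℕ × ℕ) × ℕ => q.1.2.2.1 :=
        Primrec.fst.comp (Primrec.snd.comp (Primrec.snd.comp Primrec.fst))
      have hb : Primrec fun q : ((List Bool × List Bool × ℕ) × ℕ × ℕ × ℕ) × ℕ => q.1.2.2.2 + 1 :=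
        Primrec.succ.comp (Primrec.snd.comp (Primrec.snd.comp (Primrec.snd.comp Primrec.fst)))
      exact (Primrec.pair (Primrec.nat_add.comp (Primrec.nat_mul.comp ha hp) hb)
        (Primrec.pred.comp (Primrec.nat_mul.comp hb hp))).to_comp
  · intro k l hkl
    simp only [hF]
    exact Finset.sum_le_sum_of_subset (Finset.range_mono hkl)
  · simp only [hF]
    rw [ENNReal.tsum_eq_iSup_nat]

theorem ENNReal.tsum_decode {ι : Type*} [Encodable ι] (f : ℕ → ℝ≥0∞)
    (hf : ∀ i, Encodable.decode₂ ι i = none → f i = 0) :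
    ∑' i, f i = ∑' a : ι, f (Encodable.encode a) := by
  refine (Function.Injective.tsum_eq Encodable.encode_injective fun i hi => ?_).symm
  rcases h : Encodable.decode₂ ι i with _ | a
  · exact absurd (hf i h) hi
  · exact ⟨a, Encodable.mem_decode₂.1 h⟩

/-- `decode₂` rejects numbers that are not codes, so each element of `ι` is counted exactly once. -/
theorem isLowerSemicomputable_tsum {ι : Type*} [Primcodable ι]
    {w : (List Bool × List Bool) × ι → Option ℕ} (hw : Computable w) :
    IsLowerSemicomputable fun x y => ∑' a, dyadicWeight (w ((x, y), a)) := by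
  have h := isLowerSemicomputable_tsum_nat
    (w := fun q => (Encodable.decode₂ ι q.2).bind fun a => w (q.1, a)) ?_
  · convert h using 3 with x y
    rw [ENNReal.tsum_decode (ι := ι)]
    · simp
    · intro i hi; simp [hi, dyadicWeight]
  · exact Computable.option_bind (Primrec.decode₂.to_comp.comp Computable.snd)
      (hw.comp (Computable.pair (Computable.fst.comp Computable.fst) Computable.snd))

/-! ### Positions in an enumeration -/

/-- The number of indices below `i` at which `w` has a value. -/
def valueCount {β : Type*} (w : ℕ → Option β) (i : ℕ) : ℕ :=
  Nat.rec 0 (fun k c => Option.casesOn (w k) c fun _ => c + 1) i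

theorem valueCount_succ {β : Type*} (w : ℕ → Option β) (i : ℕ) :
    valueCount w (i + 1) = valueCount w i + if (w i).isSome then 1 else 0 := by
  change (Option.casesOn (w i) (valueCount w i) fun _ => valueCount w i + 1 : ℕ) = _
  cases w i <;> rfl

theorem valueCount_mono {β : Type*} (w : ℕ → Option β) : Monotone (valueCount w) :=
  monotone_nat_of_le_succ fun i => by rw [valueCount_succ]; omega

theorem valueCount_cast {β : Type*} (w : ℕ → Option β) (i : ℕ) :
    (valueCount w i : ℝ≥0∞) = ∑ k ∈ Finset.range i, if (w k).isSome then 1 else 0 := by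
  induction i with
  | zero => simp [valueCount]
  | succ i ih => rw [Finset.sum_range_succ, ← ih, valueCount_succ]; push_cast; rfl

/-- The value of `w` at the index that is preceded by exactly `r` indices with a value. -/
def nthValue {β : Type*} (w : ℕ → Option β) (r : ℕ) : Part β :=
  (Nat.rfind fun i => Part.some ((w i).isSome && valueCount w i == r)).bind fun i => (w i : Part β)

theorem mem_nthValue {β : Type*} {w : ℕ → Option β} {i : ℕ} {b : β} (h : w i = some b) :
    b ∈ nthValue w (valueCount w i) := by
  refine Part.mem_bind (a := i) ?_ (by rw [h]; exact Part.mem_some b)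
  refine Nat.mem_rfind.2 ⟨by simp [h], fun {k} hk => ?_⟩
  have h1 := valueCount_mono w (show k + 1 ≤ i from hk)
  rw [valueCount_succ] at h1
  have h2 : ((w k).isSome && valueCount w k == valueCount w i) = false := by
    cases hw : (w k).isSome
    · rfl
    · rw [hw] at h1
      simp only [if_true] at h1
      simp only [Bool.true_and, beq_eq_false_iff_ne]
      omega
  rw [h2]
  exact Part.mem_some _

theorem Computable.valueCount {α β : Type*} [Primcodable α] [Primcodable β]
    {w : α → ℕ → Option β} (hw : Computable₂ w) :
    Computable₂ fun a i => valueCount (w a) i := by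
  refine Computable.nat_rec (f := fun q : α × ℕ => q.2) (g := fun _ => (0 : ℕ))
    (h := fun q s => Option.casesOn (w q.1 s.1) s.2 fun _ => s.2 + 1)
    Computable.snd (Computable.const 0) ?_
  refine Computable.option_casesOn (o := fun q : (α × ℕ) × ℕ × ℕ => w q.1.1 q.2.1)
    (f := fun q => q.2.2) (g := fun q _ => q.2.2 + 1) ?_ ?_ ?_
  · exact hw.comp (Computable.fst.comp Computable.fst) (Computable.fst.comp Computable.snd)
  · exact Computable.snd.comp Computable.snd
  · exact Computable.succ.comp (Computable.snd.comp (Computable.snd.comp Computable.fst))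

theorem Partrec.nthValue {α β : Type*} [Primcodable α] [Primcodable β]
    {w : α → ℕ → Option β} (hw : Computable₂ w) {r : α → ℕ} (hr : Computable r) :
    Partrec fun a => nthValue (w a) (r a) := by
  refine Partrec.bind (Partrec.rfind (p := fun a i =>
    Part.some ((w a i).isSome && _root_.valueCount (w a) i == r a)) ?_) ?_
  · exact Computable.partrec (Primrec.and.to_comp.comp (Primrec.option_isSome.to_comp.comp hw)
      (Primrec.beq.to_comp.comp (Computable.valueCount hw) (hr.comp Computable.fst)))
  · exact Computable.ofOption hw

/-! ### Counting bounds -/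

/-- Summing over first indices counts a semidecidable event once, however long it stays true. -/
theorem ENNReal.tsum_isFirst_le {f : ℕ → Bool} (hf : Monotone f) {P : Prop} [Decidable P]
    (hP : (∃ k, f k = true) ↔ P) :
    ∑' k, (if isFirst f k then (1 : ℝ≥0∞) else 0) ≤ if P then 1 else 0 := by
  by_cases h : ∃ k, f k = true
  · obtain ⟨k, hk⟩ := exists_isFirst h
    rw [if_pos (hP.1 h), tsum_eq_single k, if_pos hk]
    intro l hl
    rw [if_neg]
    exact fun h' => hl (isFirst_unique hf h' hk)
  · rw [if_neg (mt hP.2 h), le_zero_iff, ENNReal.tsum_eq_zero]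
    exact fun k => if_neg fun hk => h ⟨k, apply_of_isFirst hk⟩

theorem ENNReal.tsum_add_one_lt_le (x : ℝ≥0∞) :
    ∑' j : ℕ, (if (j : ℝ≥0∞) + 1 < x then (1 : ℝ≥0∞) else 0) ≤ x := by
  rw [ENNReal.tsum_eq_iSup_nat]
  refine iSup_le fun k => ?_
  induction k with
  | zero => simp
  | succ k ih =>
    rw [Finset.sum_range_succ]
    split_ifs with h
    · refine le_trans ?_ h.le
      gcongr
      calc _ ≤ ∑ _j ∈ Finset.range k, (1 : ℝ≥0∞) := Finset.sum_le_sum fun j _ => by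
            split_ifs <;> simp
        _ = k := by simp
    · simpa using ih

/-! ### Enumerating lower bounds for `m` -/

section Enumeration

variable (φ : List Bool × List Bool × ℕ → ℕ × ℕ)

/-- Whether the `k`-th approximation to `m(y | z)` exceeds `(j + 1) / 2 ^ l`. -/
def exceeds (z : List Bool) (l : ℕ) (y : List Bool) (j k : ℕ) : Bool :=
  decide ((j + 1) * ((φ (y, z, k)).2 + 1) < (φ (y, z, k)).1 * 2 ^ l)

variable {φ} {m : List Bool → List Bool → ℝ≥0∞}

theorem exceeds_iff (z : List Bool) (l : ℕ) (y : List Bool) (j k : ℕ) :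
    exceeds φ z l y j k = true ↔
      (j : ℝ≥0∞) + 1 < ((φ (y, z, k)).1 : ℝ≥0∞) / ((φ (y, z, k)).2 + 1) * 2 ^ l := by
  have hb : (((φ (y, z, k)).2 : ℝ≥0∞) + 1) ≠ 0 := by positivity
  have hb' : (((φ (y, z, k)).2 : ℝ≥0∞) + 1) ≠ ⊤ := by finiteness
  rw [exceeds, decide_eq_true_iff, div_eq_mul_inv, mul_right_comm, ← div_eq_mul_inv,
    ENNReal.lt_div_iff_mul_lt (Or.inl hb) (Or.inl hb')]
  exact_mod_cast Iff.rfl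

theorem exceeds_monotone
    (h : ∀ x y, Monotone fun k => ((φ (x, y, k)).1 : ℝ≥0∞) / ((φ (x, y, k)).2 + 1))
    (z : List Bool) (l : ℕ) (y : List Bool) (j : ℕ) : Monotone (exceeds φ z l y j) := by
  intro k k' hk
  rw [Bool.le_iff_imp, exceeds_iff, exceeds_iff]
  exact fun h' => h'.trans_le (mul_le_mul_left (h y z hk) _)

/-- The inequality is strict, so it holds for the supremum exactly when some approximation witnesses
it. -/
theorem exists_exceeds_iff
    (h : ∀ x y, ⨆ k, ((φ (x, y, k)).1 : ℝ≥0∞) / ((φ (x, y, k)).2 + 1) = m x y)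
    (z : List Bool) (l : ℕ) (y : List Bool) (j : ℕ) :
    (∃ k, exceeds φ z l y j k = true) ↔ (j : ℝ≥0∞) + 1 < m y z * 2 ^ l := by
  simp only [exceeds_iff, ← h y z, ENNReal.iSup_mul, lt_iSup_iff]

theorem Computable.exceeds (hφ : Computable φ) :
    Computable₂ fun (q : (List Bool × ℕ) × List Bool × ℕ) k =>
      exceeds φ q.1.1 q.1.2 q.2.1 q.2.2 k := by
  have hφ' : Computable fun q : ((List Bool × ℕ) × List Bool × ℕ) × ℕ =>
      φ (q.1.2.1, q.1.1.1, q.2) :=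
    hφ.comp (Primrec.pair (Primrec.fst.comp (Primrec.snd.comp Primrec.fst))
      (Primrec.pair (Primrec.fst.comp (Primrec.fst.comp Primrec.fst)) Primrec.snd)).to_comp
  have hj : Computable fun q : ((List Bool × ℕ) × List Bool × ℕ) × ℕ => q.1.2.2 + 1 :=
    (Primrec.succ.comp (Primrec.snd.comp (Primrec.snd.comp Primrec.fst))).to_comp
  have hl : Computable fun q : ((List Bool × ℕ) × List Bool × ℕ) × ℕ => 2 ^ q.1.1.2 :=
    (Primrec.nat_two_pow.comp (Primrec.snd.comp (Primrec.fst.comp Primrec.fst))).to_comp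
  have hlt : Computable₂ fun a b : ℕ => decide (a < b) := Primrec.nat_lt.decide.to_comp
  exact hlt.comp
    (Primrec.nat_mul.to_comp.comp hj (Computable.succ.comp (Computable.snd.comp hφ')))
    (Primrec.nat_mul.to_comp.comp (Computable.fst.comp hφ') hl)

variable (φ) in
/-- Enumerates, each of them once, the pairs `(y, j)` with `(j + 1) / 2 ^ l < m(y | z)`. -/
def enumExceeding (z : List Bool) (l i : ℕ) : Option (List Bool × ℕ) :=
  (Encodable.decode₂ ((List Bool × ℕ) × ℕ) i).bind fun t =>
    bif isFirst (exceeds φ z l t.1.1 t.1.2) t.2 then some t.1 else none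

theorem enumExceeding_encode (z : List Bool) (l : ℕ) (t : (List Bool × ℕ) × ℕ) :
    enumExceeding φ z l (Encodable.encode t) =
      bif isFirst (exceeds φ z l t.1.1 t.1.2) t.2 then some t.1 else none := by
  rw [enumExceeding, Encodable.decode₂_encode]
  rfl

theorem Computable.enumExceeding (hφ : Computable φ) :
    Computable₂ fun (q : List Bool × ℕ) i => enumExceeding φ q.1 q.2 i := by
  have h₁ : Computable₂ fun (q : (List Bool × ℕ) × List Bool × ℕ) k =>
      _root_.isFirst (_root_.exceeds φ q.1.1 q.1.2 q.2.1 q.2.2) k :=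
    Computable.isFirst (Computable.exceeds hφ)
  have h₂ : Computable fun q : ((List Bool × ℕ) × ℕ) × (List Bool × ℕ) × ℕ => (q.1.1, q.2.1) :=
    (Primrec.pair (Primrec.fst.comp Primrec.fst) (Primrec.fst.comp Primrec.snd)).to_comp
  have h₃ : Computable fun q : ((List Bool × ℕ) × ℕ) × (List Bool × ℕ) × ℕ => q.2.2 :=
    (Primrec.snd.comp Primrec.snd).to_comp
  have h₄ : Computable fun q : ((List Bool × ℕ) × ℕ) × (List Bool × ℕ) × ℕ => some q.2.1 :=
    (Primrec.option_some.comp (Primrec.fst.comp Primrec.snd)).to_comp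
  have h₅ := h₁.comp h₂ h₃
  have h₇ := (Computable.cond h₅ h₄ (Computable.const none)).to₂
  have h₆ : Computable fun q : (List Bool × ℕ) × ℕ =>
      Encodable.decode₂ ((List Bool × ℕ) × ℕ) q.2 := Primrec.decode₂.to_comp.comp Computable.snd
  exact Computable.option_bind h₆ h₇

theorem exists_enumExceeding_eq
    (h : ∀ x y, ⨆ k, ((φ (x, y, k)).1 : ℝ≥0∞) / ((φ (x, y, k)).2 + 1) = m x y)
    {z y : List Bool} {l j : ℕ} (hj : (j : ℝ≥0∞) + 1 < m y z * 2 ^ l) :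
    ∃ i, enumExceeding φ z l i = some (y, j) := by
  obtain ⟨k, hk⟩ := exists_isFirst ((exists_exceeds_iff h z l y j).2 hj)
  exact ⟨Encodable.encode (((y, j), k) : (List Bool × ℕ) × ℕ), by
    rw [enumExceeding_encode, hk, cond_true]⟩

/-- Each `y` accounts for at most `m y z * 2 ^ l` values, and the masses sum to at most one. -/
theorem valueCount_enumExceeding_le (hm : IsCondSemimeasure m)
    (hmono : ∀ x y, Monotone fun k => ((φ (x, y, k)).1 : ℝ≥0∞) / ((φ (x, y, k)).2 + 1))
    (h : ∀ x y, ⨆ k, ((φ (x, y, k)).1 : ℝ≥0∞) / ((φ (x, y, k)).2 + 1) = m x y)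
    (z : List Bool) (l i : ℕ) : valueCount (enumExceeding φ z l) i ≤ 2 ^ l := by
  have : (valueCount (enumExceeding φ z l) i : ℝ≥0∞) ≤ 2 ^ l := by
    rw [valueCount_cast]
    refine (ENNReal.sum_le_tsum _).trans ?_
    rw [ENNReal.tsum_decode (ι := (List Bool × ℕ) × ℕ)
      (hf := fun i hi => by simp [enumExceeding, hi]), ENNReal.tsum_prod', ENNReal.tsum_prod']
    calc _ ≤ ∑' (y : List Bool) (j : ℕ), (if (j : ℝ≥0∞) + 1 < m y z * 2 ^ l then 1 else 0) := by
          gcongr with y j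
          refine le_trans (le_of_eq (tsum_congr fun k => ?_)) (ENNReal.tsum_isFirst_le
            (exceeds_monotone hmono z l y j) (exists_exceeds_iff h z l y j))
          rw [enumExceeding_encode]
          cases isFirst (exceeds φ z l y j) k <;> rfl
      _ ≤ ∑' y, m y z * 2 ^ l := by
          gcongr with y
          exact ENNReal.tsum_add_one_lt_le _
      _ ≤ 2 ^ l := by
          rw [ENNReal.tsum_mul_right]
          exact mul_le_of_le_one_left' (hm z)
  exact_mod_cast this

/-- Index `i` itself holds a value, so the count before it is strictly smaller and fits into `l`
bits. -/
theorem valueCount_enumExceeding_lt (hm : IsCondSemimeasure m)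
    (hmono : ∀ x y, Monotone fun k => ((φ (x, y, k)).1 : ℝ≥0∞) / ((φ (x, y, k)).2 + 1))
    (h : ∀ x y, ⨆ k, ((φ (x, y, k)).1 : ℝ≥0∞) / ((φ (x, y, k)).2 + 1) = m x y)
    {z : List Bool} {l i : ℕ} {t : List Bool × ℕ} (hi : enumExceeding φ z l i = some t) :
    valueCount (enumExceeding φ z l) i < 2 ^ l := by
  have := valueCount_enumExceeding_le hm hmono h z l (i + 1)
  rw [valueCount_succ, hi] at this
  simpa using this

end Enumeration

/-! ### The standard threshold -/

theorem plainComplexity_le {U : List Bool →. List Bool} {x p : List Bool} (h : x ∈ U p) :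
    plainComplexity U x ≤ p.length :=
  iInf₂_le p h

theorem exists_program_of_plainComplexity_le {U : List Bool →. List Bool} {x : List Bool} {k : ℕ}
    (h : plainComplexity U x ≤ k) : ∃ p, x ∈ U p ∧ p.length ≤ k := by
  by_contra! hc
  have : ((k + 1 : ℕ) : ℕ∞) ≤ plainComplexity U x :=
    le_iInf₂ fun p hp => by exact_mod_cast hc p hp
  have := this.trans h
  norm_cast at this
  omega

/-- A single constant `M` bounds the complexity of `[y, s]` for the first strings `s`, as many as
`m(y | n) * 2 ^ l` allows, where `n` is the length of the binary expansion of `l`. -/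
theorem exists_plainComplexity_pair_bits_le {V : List Bool →. List Bool}
    (hV : IsUniversalDecompressor V) {pair : List Bool → List Bool → List Bool}
    (hpair : Computable₂ pair) {m : List Bool → List Bool → ℝ≥0∞} (hm : IsCondSemimeasure m)
    (hm' : IsLowerSemicomputable m) :
    ∃ M : ℕ, ∀ (l : ℕ) (y : List Bool) (j : ℕ),
      (j : ℝ≥0∞) + 1 < m y (Nat.bits (Nat.size l)) * 2 ^ l →
        plainComplexity V (pair y (Nat.bits j)) ≤ l + M := by
  obtain ⟨φ, hφ, hφm⟩ := hm'
  have hmono := fun x y => (hφm x y).1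
  have hsup := fun x y => (hφm x y).2
  let z : ℕ → List Bool := fun l => Nat.bits l.bits.length
  have hz : Primrec z := Primrec.nat_bits.comp (Primrec.list_length.comp Primrec.nat_bits)
  -- The length of `p` supplies both the precision `l` and the condition `z l`; the digits of `p`
  -- supply the position.
  let U : List Bool →. List Bool := fun p =>
    (nthValue (enumExceeding φ (z p.length) p.length) (natOfBits p)).map
      fun t => pair t.1 (Nat.bits t.2)
  have hU : Partrec U := by
    have hlen : Primrec fun q : List Bool × ℕ => q.1.length := Primrec.list_length.comp Primrec.fst
    have h₁ : Computable fun q : List Bool × ℕ => (z q.1.length, q.1.length) :=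
      (Primrec.pair (hz.comp hlen) hlen).to_comp
    have h₂ := ((Computable.enumExceeding hφ).comp h₁ Computable.snd).to₂
    have h₃ : Computable fun q : List Bool × List Bool × ℕ => q.2.1 :=
      (Primrec.fst.comp Primrec.snd).to_comp
    have h₄ : Computable fun q : List Bool × List Bool × ℕ => Nat.bits q.2.2 :=
      (Primrec.nat_bits.comp (Primrec.snd.comp Primrec.snd)).to_comp
    exact Partrec.map (Partrec.nthValue h₂ Primrec.natOfBits.to_comp) (hpair.comp h₃ h₄).to₂
  obtain ⟨M, hM⟩ := hV.2 U hU
  refine ⟨M, fun l y j hj => (hM _).trans ?_⟩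
  gcongr
  have hzl : z l = Nat.bits (Nat.size l) := by simp only [z, Nat.size_eq_bits_len]
  rw [← hzl] at hj
  obtain ⟨i, hi⟩ := exists_enumExceeding_eq hsup hj
  obtain ⟨p, rfl, hpr⟩ := exists_natOfBits_eq l _ (valueCount_enumExceeding_lt hm hmono hsup hi)
  refine plainComplexity_le (Part.mem_map (fun t : List Bool × ℕ => pair t.1 (Nat.bits t.2)) ?_ :
    pair (y, j).1 (Nat.bits (y, j).2) ∈ U p)
  rw [hpr]
  exact mem_nthValue hi

/-- If `S` had `t` elements with `t + 1 < x`, it would contain the `t + 1` distinct expansions of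
`0, ..., t`. -/
theorem le_encard_add_one {x : ℝ≥0∞} {S : Set (List Bool)}
    (h : ∀ j : ℕ, (j : ℝ≥0∞) + 1 < x → Nat.bits j ∈ S) : x ≤ (S.encard : ℝ≥0∞) + 1 := by
  by_contra! hc
  have hfin : S.encard ≠ ⊤ := by rintro h; simp [h] at hc
  obtain ⟨t, ht⟩ := ENat.ne_top_iff_exists.1 hfin
  rw [← ht] at hc
  have hsub : Nat.bits '' (Finset.range (t + 1) : Set ℕ) ⊆ S := by
    rintro _ ⟨j, hj, rfl⟩
    refine h j (lt_of_le_of_lt ?_ hc)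
    have : j ≤ t := by simpa [Nat.lt_succ_iff] using hj
    simp only [ENat.toENNReal_coe]
    gcongr
  have := Set.encard_le_encard hsub
  rw [Nat.bits_injective.encard_image, Set.encard_coe_eq_coe_finsetCard, ← ht,
    Finset.card_range] at this
  norm_cast at this
  omega

theorem exists_standard_threshold {V : List Bool →. List Bool}
    (hV : IsUniversalDecompressor V) {pair : List Bool → List Bool → List Bool}
    (hpair : Computable₂ pair) {m : List Bool → List Bool → ℝ≥0∞} (hm : IsCondSemimeasure m)
    (hm' : IsLowerSemicomputable m) :
    ∃ (a : ℕ) (c : ℝ≥0), 0 < c ∧ ∀ (n : ℕ) (y : List Bool),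
      (y.length : ℝ) < (2 : ℝ) ^ n / 2 - (a : ℝ) →
        m y (Nat.bits n) ≤
          (c : ℝ≥0∞) * ((extensionSet V pair n 0 y).encard : ℝ≥0∞) / 2 ^ (2 ^ n : ℕ) := by
  obtain ⟨M₁, hM₁⟩ := exists_plainComplexity_pair_bits_le hV hpair hm hm'
  obtain ⟨M₂, hM₂⟩ := hV.2 (fun y => Part.some (pair y []))
    (hpair.comp Computable.id (Computable.const [])).partrec
  -- `M₁ + 1` is the gap between `l` and `2 ^ n`, and `M₂` the cost of describing `[y, []]` by `y`.
  -- The factor is `2 ^ (M₁ + 1)` for the gap, doubled to absorb the `+ 1` in the count.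
  refine ⟨M₁ + 1 + M₂, 2 ^ (M₁ + 2), by positivity, fun n y hy => ?_⟩
  have hy' : 2 * (y.length + (M₁ + 1 + M₂)) < 2 ^ n := by
    have : (2 : ℝ) * (y.length + (M₁ + 1 + M₂)) < 2 ^ n := by push_cast at hy; linarith
    exact_mod_cast this
  -- Nonemptiness of the extension set is what lets the `+ 1` be absorbed; it comes from the bound
  -- on the length of `y`.
  have hnil : [] ∈ extensionSet V pair n 0 y := by
    have h : plainComplexity (fun y => Part.some (pair y [])) (pair y []) ≤ y.length :=
      plainComplexity_le (p := y) (Part.mem_some _)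
    have h' : ((y.length + M₂ : ℕ) : ℕ∞) ≤ (2 ^ n + 0 : ℕ) := by
      exact_mod_cast (by omega : y.length + M₂ ≤ 2 ^ n + 0)
    refine le_trans ((hM₂ (pair y [])).trans ?_) h'
    push_cast
    gcongr
  obtain ⟨l, hl⟩ : ∃ l, l + (M₁ + 1) = 2 ^ n := ⟨2 ^ n - (M₁ + 1), by omega⟩
  -- The extra `1` in the gap forces `l < 2 ^ n`; the gap being less than half of `2 ^ n` forces `l
  -- ≥ 2 ^ (n - 1)`.
  have hsize : Nat.size l = n := by
    refine le_antisymm (Nat.size_le.2 (by omega)) ?_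
    rcases n with _ | n
    · exact Nat.zero_le _
    · exact Nat.lt_size.2 (by rw [pow_succ] at hl hy'; omega)
  have hcard : m y (Nat.bits n) * 2 ^ l ≤
      ((extensionSet V pair n 0 y).encard : ℝ≥0∞) + 1 := by
    refine le_encard_add_one fun j hj => ?_
    refine (hM₁ l y j (by rwa [hsize])).trans ?_
    norm_cast
    omega
  have hone : (1 : ℝ≥0∞) ≤ ((extensionSet V pair n 0 y).encard : ℝ≥0∞) := by
    have : (1 : ℕ∞) ≤ (extensionSet V pair n 0 y).encard :=
      Set.one_le_encard_iff_nonempty.2 ⟨_, hnil⟩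
    exact_mod_cast this
  rw [ENNReal.le_div_iff_mul_le (Or.inl (by positivity)) (Or.inl (by finiteness)), ← hl, pow_add,
    ← mul_assoc]
  calc _ ≤ (((extensionSet V pair n 0 y).encard : ℝ≥0∞) +
        ((extensionSet V pair n 0 y).encard : ℝ≥0∞)) * 2 ^ (M₁ + 1) := by
        gcongr
        exact hcard.trans (by gcongr)
    _ = _ := by push_cast; ring

/-! ### A summable weighting of all programs -/

theorem tsum_length_eq (f : ℕ → ℝ≥0∞) :
    ∑' p : List Bool, f p.length = ∑' k, 2 ^ k * f k := by
  rw [← (Equiv.sigmaFiberEquiv (List.length (α := Bool))).tsum_eq, ENNReal.tsum_sigma']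
  refine tsum_congr fun k => ?_
  have h : ∀ p : {p : List Bool // p.length = k},
      f (Equiv.sigmaFiberEquiv (List.length (α := Bool)) ⟨k, p⟩).length = f k := by
    rintro ⟨p, rfl⟩; rfl
  simp only [h]
  change ∑' _ : List.Vector Bool k, f k = _
  rw [tsum_fintype, Finset.sum_const, Finset.card_univ, card_vector, Fintype.card_bool,
    nsmul_eq_mul]
  push_cast
  rfl

/-- The exponent of the weight that a program of length `k` gets when the threshold is `N`. -/
def weightExponent (N k : ℕ) : ℕ := N + 2 * (k - N) + 2

/-- Lengths below `N` contribute at most `2 ^ N * 2 ^ (-(N + 2)) = 1 / 4`. Length `N + k`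
contributes `2 ^ (-(k + 2))`, and these sum to `1 / 2`. -/
theorem tsum_weightExponent_le_one (N : ℕ) :
    ∑' p : List Bool, ((2 : ℝ≥0∞) ^ weightExponent N p.length)⁻¹ ≤ 1 := by
  rw [tsum_length_eq fun k => ((2 : ℝ≥0∞) ^ weightExponent N k)⁻¹,
    ← ENNReal.summable.sum_add_tsum_nat_add' (k := N)]
  have h2 : ∀ k : ℕ, (2 : ℝ≥0∞) ^ k ≠ 0 := fun k => by positivity
  have h2' : ∀ k : ℕ, (2 : ℝ≥0∞) ^ k ≠ ⊤ := fun k => by finiteness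
  have hcancel : ∀ a b : ℕ, (2 : ℝ≥0∞) ^ a * (2 ^ (a + b))⁻¹ = (2 ^ b)⁻¹ := fun a b => by
    rw [pow_add, ENNReal.mul_inv (Or.inl (h2 a)) (Or.inl (h2' a)), ← mul_assoc,
      ENNReal.mul_inv_cancel (h2 a) (h2' a), one_mul]
  have hinit : ∑ k ∈ Finset.range N, (2 : ℝ≥0∞) ^ k * (2 ^ weightExponent N k)⁻¹ ≤ 2⁻¹ := by
    have hsum : ∀ n : ℕ, ∑ k ∈ Finset.range n, (2 : ℝ≥0∞) ^ k ≤ 2 ^ n := fun n => by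
      induction n with
      | zero => simp
      | succ n ih =>
        rw [Finset.sum_range_succ, pow_succ, mul_two]
        gcongr
    calc _ = ∑ k ∈ Finset.range N, (2 : ℝ≥0∞) ^ k * (2 ^ (N + 2))⁻¹ :=
          Finset.sum_congr rfl fun k hk => by
            rw [weightExponent, Nat.sub_eq_zero_of_le (Finset.mem_range.1 hk).le]
      _ ≤ 2 ^ N * (2 ^ (N + 2))⁻¹ := by
          rw [← Finset.sum_mul]
          gcongr
          exact hsum N
      _ = (2 ^ 2)⁻¹ := hcancel _ _
      _ ≤ 2⁻¹ := by
          rw [ENNReal.inv_le_inv]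
          norm_num
  have htail : ∑' k, (2 : ℝ≥0∞) ^ (k + N) * (2 ^ weightExponent N (k + N))⁻¹ = 2⁻¹ := by
    calc _ = ∑' k : ℕ, (2⁻¹ : ℝ≥0∞) ^ k * (2⁻¹) ^ 2 := tsum_congr fun k => by
          have : weightExponent N (k + N) = (k + N) + (k + 2) := by
            rw [weightExponent, Nat.add_sub_cancel]; ring
          rw [this, hcancel, ← pow_add, ENNReal.inv_pow]
      _ = 2⁻¹ := by
          rw [ENNReal.tsum_mul_right, ENNReal.tsum_geometric, ENNReal.one_sub_inv_two, inv_inv, sq,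
            ← mul_assoc, ENNReal.mul_inv_cancel two_ne_zero ENNReal.ofNat_ne_top, one_mul]
  rw [htail, ← ENNReal.inv_two_add_inv_two]
  gcongr

theorem ENNReal.tsum_indicator_le_one {α : Type*} {S : α → Prop} [DecidablePred S]
    (hS : ∀ a b, S a → S b → a = b) : ∑' a, (if S a then (1 : ℝ≥0∞) else 0) ≤ 1 := by
  by_cases h : ∃ a, S a
  · obtain ⟨a, ha⟩ := h
    rw [tsum_eq_single a fun b hb => if_neg fun hb' => hb (hS b a hb' ha), if_pos ha]
  · rw [ENNReal.tsum_eq_zero.2 fun a => if_neg fun ha => h ⟨a, ha⟩]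
    exact zero_le

/-! ### The semimeasure generated by the programs of `V` -/

section Extensions

open Encodable (encode)
open Nat.Partrec (Code)

/-- Whether the code `c`, run for `t` steps on the program `p`, outputs `x`. -/
def outputsWithin (c : Code) (p x : List Bool) (t : ℕ) : Bool :=
  decide (c.evaln t (encode p) = some (encode x))

theorem outputsWithin_monotone (c : Code) (p x : List Bool) : Monotone (outputsWithin c p x) := by
  intro t t' ht
  rw [Bool.le_iff_imp]
  simp only [outputsWithin, decide_eq_true_iff]
  exact fun h => Code.evaln_mono ht h

theorem exists_code_outputsWithin {V : List Bool →. List Bool} (hV : Partrec V) :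
    ∃ c : Code, ∀ p x, (∃ t, outputsWithin c p x t = true) ↔ x ∈ V p := by
  obtain ⟨c, hc⟩ := Code.exists_code.1 hV
  refine ⟨c, fun p x => ?_⟩
  have : encode x ∈ c.eval (encode p) ↔ x ∈ V p := by
    rw [hc]
    simp
  rw [← this, Code.evaln_complete]
  simp only [outputsWithin, decide_eq_true_iff, Option.mem_def]

theorem Computable.outputsWithin (c : Code) :
    Computable₂ fun (q : List Bool × List Bool) t => outputsWithin c q.1 q.2 t := by
  have h₁ : Primrec fun q : (List Bool × List Bool) × ℕ => ((q.2, c), encode q.1.1) :=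
    Primrec.pair (Primrec.pair Primrec.snd (Primrec.const c))
      (Primrec.encode.comp (Primrec.fst.comp Primrec.fst))
  have h₂ : Primrec fun q : (List Bool × List Bool) × ℕ => some (encode q.1.2) :=
    Primrec.option_some.comp (Primrec.encode.comp (Primrec.snd.comp Primrec.fst))
  exact (Primrec.eq.comp (Code.primrec_evaln.comp h₁) h₂).decide.to_comp

/-- The exponent of the weight that the computation of `[y, s]` from the program `p` in exactly
`t` steps contributes to `y` under the condition `z`. -/
def extensionWeight (c : Code) (pair : List Bool → List Bool → List Bool)
    (q : (List Bool × List Bool) × List Bool × List Bool × ℕ) : Option ℕ :=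
  bif isFirst (outputsWithin c q.2.1 (pair q.1.1 q.2.2.1)) q.2.2.2 then
    some (weightExponent (2 ^ natOfBits q.1.2) q.2.1.length) else none

theorem Computable.extensionWeight (c : Code) {pair : List Bool → List Bool → List Bool}
    (hpair : Computable₂ pair) : Computable (extensionWeight c pair) := by
  have h₁ := Computable.isFirst (Computable.outputsWithin c)
  have h₂ : Computable fun q : (List Bool × List Bool) × List Bool × List Bool × ℕ => q.1.1 :=
    Computable.fst.comp Computable.fst
  have h₃ : Computable fun q : (List Bool × List Bool) × List Bool × List Bool × ℕ => q.2.2.1 :=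
    Computable.fst.comp (Computable.snd.comp Computable.snd)
  have h₄ : Computable fun q : (List Bool × List Bool) × List Bool × List Bool × ℕ => q.2.1 :=
    Computable.fst.comp Computable.snd
  have h₅ : Computable fun q : (List Bool × List Bool) × List Bool × List Bool × ℕ => q.2.2.2 :=
    Computable.snd.comp (Computable.snd.comp Computable.snd)
  have h₆ := h₁.comp (h₄.pair (hpair.comp h₂ h₃)) h₅
  have hN : Primrec fun q : (List Bool × List Bool) × List Bool × List Bool × ℕ =>
      2 ^ natOfBits q.1.2 :=
    Primrec.nat_two_pow.comp (Primrec.natOfBits.comp (Primrec.snd.comp Primrec.fst))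
  have hk : Primrec fun q : (List Bool × List Bool) × List Bool × List Bool × ℕ => q.2.1.length :=
    Primrec.list_length.comp (Primrec.fst.comp Primrec.snd)
  have h₇ := Primrec.option_some.comp (Primrec.nat_add.comp (Primrec.nat_add.comp hN
    (Primrec.nat_double.comp (Primrec.nat_sub.comp hk hN))) (Primrec.const 2))
  exact Computable.cond h₆ h₇.to_comp (Computable.const none)

theorem dyadicWeight_cond (b : Bool) (e : ℕ) :
    dyadicWeight (bif b then some e else none) = (if b then 1 else 0) * (2 ^ e)⁻¹ := by
  cases b <;> simp [dyadicWeight]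

variable {V : List Bool →. List Bool} {c : Code} {pair : List Bool → List Bool → List Bool}

/-- Summing over programs first, each `p` spends its weight at most once: it has at most one output,
which by injectivity codes at most one pair. Any condition `z` is read as a number, canonical
expansion or not, so the bound holds for all `z`. -/
theorem isCondSemimeasure_extensionWeight
    (hc : ∀ p x, (∃ t, outputsWithin c p x t = true) ↔ x ∈ V p)
    (hpair : Function.Injective2 pair) :
    IsCondSemimeasure fun y z => ∑' a, dyadicWeight (extensionWeight c pair ((y, z), a)) := by
  classical
  intro z
  have h : ∀ p : List Bool, ∑' (y : List Bool) (b : List Bool × ℕ),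
      dyadicWeight (extensionWeight c pair ((y, z), p, b)) ≤
        (2 ^ weightExponent (2 ^ natOfBits z) p.length)⁻¹ := fun p => by
    simp only [extensionWeight, dyadicWeight_cond, ENNReal.tsum_mul_right]
    refine mul_le_of_le_one_left' ?_
    calc _ ≤ ∑' (y : List Bool) (s : List Bool), (if pair y s ∈ V p then (1 : ℝ≥0∞) else 0) := by
          gcongr with y
          rw [ENNReal.tsum_prod']
          gcongr with s
          exact ENNReal.tsum_isFirst_le (outputsWithin_monotone c p (pair y s)) (hc p (pair y s))
      _ ≤ 1 := by
          rw [← ENNReal.tsum_prod (f := fun y s => if pair y s ∈ V p then (1 : ℝ≥0∞) else 0)]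
          refine ENNReal.tsum_indicator_le_one fun a b ha hb => ?_
          obtain ⟨h₁, h₂⟩ := hpair (Part.mem_unique ha hb)
          exact Prod.ext h₁ h₂
  calc _ = ∑' (p : List Bool) (y : List Bool) (b : List Bool × ℕ),
        dyadicWeight (extensionWeight c pair ((y, z), p, b)) := by
        simp only [ENNReal.tsum_prod' (α := List Bool) (β := List Bool × ℕ)]
        exact ENNReal.tsum_comm
    _ ≤ ∑' p : List Bool, (2 ^ weightExponent (2 ^ natOfBits z) p.length)⁻¹ :=
        ENNReal.tsum_le_tsum h
    _ ≤ 1 := tsum_weightExponent_le_one _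

/-- Each `s` in the extension set has a program of length at most `2 ^ n + δ`, whose halting time
selects one term of the sum. Distinct `s` select distinct terms. -/
theorem encard_extensionSet_mul_le
    (hc : ∀ p x, (∃ t, outputsWithin c p x t = true) ↔ x ∈ V p) (n δ : ℕ) (y : List Bool) :
    ((extensionSet V pair n δ y).encard : ℝ≥0∞) * (2 ^ (2 ^ n + 2 * δ + 2))⁻¹ ≤
      ∑' a, dyadicWeight (extensionWeight c pair ((y, Nat.bits n), a)) := by
  have h : ∀ s : extensionSet V pair n δ y, ∃ b : List Bool × ℕ,
      ((2 : ℝ≥0∞) ^ (2 ^ n + 2 * δ + 2))⁻¹ ≤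
        dyadicWeight (extensionWeight c pair ((y, Nat.bits n), b.1, s, b.2)) := by
    rintro ⟨s, hs⟩
    obtain ⟨p, hp, hlen⟩ := exists_program_of_plainComplexity_le hs
    obtain ⟨t, ht⟩ := exists_isFirst ((hc p _).2 hp)
    refine ⟨(p, t), ?_⟩
    simp only [extensionWeight, ht, cond_true, dyadicWeight, natOfBits_bits, weightExponent]
    rw [ENNReal.inv_le_inv]
    gcongr
    · norm_num
    · omega
  choose f hf using h
  rw [← ENNReal.tsum_set_const]
  calc _ ≤ ∑' s : extensionSet V pair n δ y,
        dyadicWeight (extensionWeight c pair ((y, Nat.bits n), (f s).1, s, (f s).2)) :=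
        ENNReal.tsum_le_tsum hf
    _ ≤ _ := ENNReal.tsum_comp_le_tsum_of_injective
        (f := fun s : extensionSet V pair n δ y => ((f s).1, (s : List Bool), (f s).2))
        (fun s s' hs => Subtype.ext (Prod.ext_iff.1 (Prod.ext_iff.1 hs).2).1)
        fun a => dyadicWeight (extensionWeight c pair ((y, Nat.bits n), a))

end Extensions

/-! ### The relaxed threshold and the conclusion -/

theorem exists_relaxed_threshold {V : List Bool →. List Bool} (hV : Partrec V)
    {pair : List Bool → List Bool → List Bool} (hpair : Computable₂ pair)
    (hpair_inj : Function.Injective2 pair) {m : List Bool → List Bool → ℝ≥0∞}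
    (hm : IsUniversalSemimeasure m) :
    ∃ c : ℝ≥0, 0 < c ∧ ∀ (n δ : ℕ) (y : List Bool),
      (c : ℝ≥0∞) * ((extensionSet V pair n δ y).encard : ℝ≥0∞) / 2 ^ (2 ^ n + 2 * δ : ℕ) ≤
        m y (Nat.bits n) := by
  obtain ⟨code, hcode⟩ := exists_code_outputsWithin hV
  obtain ⟨c, hc, hle⟩ := hm.2.2 _ (isCondSemimeasure_extensionWeight hcode hpair_inj)
    (isLowerSemicomputable_tsum (Computable.extensionWeight code hpair))
  -- `c` is the domination constant, and `4` pays for the `+ 2` in `weightExponent`.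
  refine ⟨(c * 4)⁻¹, by positivity, fun n δ y => ?_⟩
  have h := (encard_extensionSet_mul_le hcode n δ y).trans (hle y (Nat.bits n))
  rw [mul_comm (c : ℝ≥0∞), ← ENNReal.div_le_iff_le_mul (Or.inl (by simpa using hc.ne'))
    (Or.inl ENNReal.coe_ne_top)] at h
  refine le_trans (le_of_eq ?_) h
  rw [ENNReal.coe_inv (by positivity), pow_add 2 (2 ^ n + 2 * δ) 2,
    ENNReal.mul_inv (Or.inl (by positivity)) (Or.inl (by finiteness)), ENNReal.coe_mul,
    ENNReal.mul_inv (Or.inl (by simpa using hc.ne')) (Or.inl ENNReal.coe_ne_top)]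
  norm_num [div_eq_mul_inv]
  ring

theorem mainTheorem8
    (V : List Bool →. List Bool) (hV : IsUniversalDecompressor V)
    (pair : List Bool → List Bool → List Bool)
    (hpair : Computable₂ pair) (hpair_inj : Function.Injective2 pair)
    (m : List Bool → List Bool → ℝ≥0∞) (hm : IsUniversalSemimeasure m) :
    ∃ (a A : ℕ) (c₁ c₂ : ℝ≥0), 0 < c₁ ∧ 0 < c₂ ∧
      ∀ (n : ℕ) (y : List Bool), (y.length : ℝ) < (2 : ℝ) ^ n / 2 - (a : ℝ) →
        m y (Nat.bits n) ≤
            (c₁ : ℝ≥0∞) * ((extensionSet V pair n 0 y).encard : ℝ≥0∞) / 2 ^ (2 ^ n : ℕ) ∧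
        ∀ δ : ℕ,
          (c₂ : ℝ≥0∞) * ((extensionSet V pair n δ y).encard : ℝ≥0∞) / 2 ^ (2 ^ n + A * δ : ℕ) ≤
            m y (Nat.bits n) := by
  obtain ⟨a, c₁, hc₁, h₁⟩ := exists_standard_threshold hV hpair hm.1 hm.2.1
  obtain ⟨c₂, hc₂, h₂⟩ := exists_relaxed_threshold hV.1 hpair hpair_inj hm
  -- `A = 2` is the rate at which `weightExponent` charges length beyond the threshold.
  exact ⟨a, 2, c₁, c₂, hc₁, hc₂, fun n y hy => ⟨h₁ n y hy, fun δ => h₂ n δ y⟩⟩
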